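/- For a partition $\lambda=(\lambda_1\ge\lambda_2\ge\cdots\ge\lambda_m\ge 1)$, let $\mathsf{Diff}_2$ be the set of those with $\lambda_i-\lambda_{i+1}\ge 2$ for $1\le i<m$. For $\lambda\in\mathsf{Diff}_2$ with $m$ parts let $col(\lambda)$ be the partition formed by the (nonempty) columns of the Ferrers diagram with row lengths $(\lambda_1-(2m-1),\lambda_2-(2m-3),\dots,\lambda_m-1)$, i.e. the conjugate of this sequence. Write $3^a2^b1^c$ for the partition with exactly $a$ parts $3$, $b$ parts $2$, $c$ parts $1$ and no other parts. Let $N\ge 1$ and let $k,j,\ell\ge 0$ be integers. The number of partitions of $N$ into parts congruent to $1$ or $4$ modulo $5$ with exactly $k$ $1$'s, exactly $j$ $4$'s and exactly $\ell$ $6$'s is equal to the number of partitions $\lambda\in\mathsf{Diff}_2$ of $N$ such that 1. if $\lambda$ has at least six parts, then $col(\lambda)$ has exactly $k$ $1$'s, $j$ $4$'s and $\ell$ $6$'s; 2. if $\lambda$ has four or five parts, then $col(\lambda)$ has exactly $k$ $1$'s, exactly $j$ $4$'s, and exactly $2\ell$ or $2\ell+1$ $3$'s; 3. if $\lambda$ has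 three parts, then (a) $col(\lambda)=3^{2\ell}2^{2j}1^k$, or (b) $col(\lambda)=3^{2\ell}2^{2j+1}1^k$, or (c) $col(\lambda)=3^{2\ell-3}2^{2j}1^k$ and $\ell\ge 2$, or (d) $col(\lambda)=3^{2\ell+1}2^{2j+1}1^k$; 4. if $\lambda$ has two parts, then (a) $col(\lambda)=2^{2j-2}1^k$, $j\ge 1$ and $\ell=0$, or (b) $col(\lambda)=2^{2j+1}1^k$ and $\ell=1$; 5. if $\lambda$ has one part, then $col(\lambda)=1^{k-1}$, $k\ge 1$ and $j=\ell=0$. -/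

import Mathlib

namespace RRRefinement

/-- The parts `λ₁ ≥ λ₂ ≥ ⋯ ≥ λ_m` of a partition, listed in weakly decreasing order. -/
def sortedParts {N : ℕ} (p : N.Partition) : List ℕ :=
  p.parts.sort (fun a b => b ≤ a)

/-- The set `Diff₂`: consecutive parts differ by at least two. -/
def Diff2 {N : ℕ} (p : N.Partition) : Prop :=
  (sortedParts p).IsChain (fun a b => b + 2 ≤ a)

instance {N : ℕ} (p : N.Partition) : Decidable (Diff2 p) :=
  inferInstanceAs (Decidable ((sortedParts p).IsChain (fun a b => b + 2 ≤ a)))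

/-- The sequence `(λ₁ - (2m-1), λ₂ - (2m-3), …, λ_m - 1)`, where `m` is the number of parts.
Positions are counted from `0` here. For a partition in `Diff₂` no entry is truncated. -/
def removeStaircase {N : ℕ} (p : N.Partition) : List ℕ :=
  (sortedParts p).mapIdx (fun i a => a - (2 * (p.parts.card - i) - 1))

/-- The multiset of the column lengths of the Ferrers diagram whose row lengths are the entries
of `s` (zero entries give empty rows): the column with index `c`, for `c = 0, 1, …, max s - 1`,
has one cell for each entry of `s` that is larger than `c`. -/
def columns (s : Multiset ℕ) : Multiset ℕ :=
  (Multiset.range s.sup).map (fun c => (s.filter (fun a => c < a)).card)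

/-- The partition `col(λ)`, as the multiset of its (positive) parts. -/
def col {N : ℕ} (p : N.Partition) : Multiset ℕ :=
  columns (removeStaircase p : Multiset ℕ)

/-- The partition `3^a 2^b 1^c`, as the multiset of its parts. -/
def threesTwosOnes (a b c : ℕ) : Multiset ℕ :=
  Multiset.replicate a 3 + Multiset.replicate b 2 + Multiset.replicate c 1

end RRRefinement

/-! Removing the staircase `2m-1, …, 3, 1`, of total `m²`, and conjugating turns a partition in
`Diff₂` with `m` parts into an arbitrary partition into parts at most `m` (`card_diff2_eq_coeff`).
Fixing the multiplicity of an allowed part `a` to be `k` multiplies a generating function by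
`X^(a*k) * (1 - X^a)` (`partGF_count_eq`). Hence, with `w = k + 4j + 6l` and `P =
(1-X)(1-X^4)(1-X^6)`, the congruence side is `X^w P G`, where `G` counts partitions into parts `±1`
mod `5`. The first Rogers–Ramanujan identity gives `G = ∑ X^(m²)/(X)_m`, so it suffices to compare
with `X^w P ∑ X^(m²)/(X)_m`.

For each `m ≥ 4` the terms agree exactly (`colGF_of_four_le`). The terms `m < 4` agree only in
total: `P` times their sum is `1 + X^9 + X^11 + X^14` (`sum_eulerInv_lt_four`). Cases 3(a), (b), (d)
supply `X^w` times the last three monomials; the remaining `X^w` is distributed by size over 3(c),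
two parts and one part, with `k = j = l = 0` left to the empty partition.

Rogers–Ramanujan is proved by a Bailey chain. The finite theta sums `thetaSum 1 a n` are known for
`a = 0` by the `q`-binomial theorem, and two Bailey steps reach `a = 2`. In base `X^5` the same
theta series is a product. Working modulo `X^(n+1)` replaces the limit. -/

namespace RRRefinement

open PowerSeries Finset

/-! ### Gaussian binomials and the finite `q`-binomial theorem. -/

/-- The Gaussian binomial coefficient with base `y`, given by the Pascal recurrence. -/
def qbinom {R : Type*} [CommRing R] (y : R) : ℕ → ℕ → R
  | _, 0 => 1
  | 0, _ + 1 => 0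
  | n + 1, k + 1 => qbinom y n k + y ^ (k + 1) * qbinom y n (k + 1)

/-- The `q`-Pochhammer symbol `(y; y)_n`. -/
def qfact {R : Type*} [CommRing R] (y : R) (n : ℕ) : R :=
  ∏ i ∈ range n, (1 - y ^ (i + 1))

section Ring
variable {R : Type*} [CommRing R] (y : R)

@[simp] lemma qbinom_zero_right (n : ℕ) : qbinom y n 0 = 1 := by
  cases n <;> rfl

lemma qbinom_succ_succ (n k : ℕ) :
    qbinom y (n + 1) (k + 1) = qbinom y n k + y ^ (k + 1) * qbinom y n (k + 1) := rfl

lemma qbinom_eq_zero {n k : ℕ} (h : n < k) : qbinom y n k = 0 := by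
  induction n generalizing k with
  | zero => cases k with
    | zero => omega
    | succ k => rfl
  | succ n ih => cases k with
    | zero => omega
    | succ k => rw [qbinom_succ_succ, ih (by omega), ih (by omega)]; simp

@[simp] lemma qfact_zero : qfact y 0 = 1 := by simp [qfact]

lemma qfact_succ (n : ℕ) : qfact y (n + 1) = qfact y n * (1 - y ^ (n + 1)) := by
  simp [qfact, prod_range_succ]

lemma qbinom_mul_qfact (k r : ℕ) :
    qbinom y (k + r) k * qfact y k * qfact y r = qfact y (k + r) := by
  induction h : k + r generalizing k r with
  | zero =>
    obtain ⟨rfl, rfl⟩ : k = 0 ∧ r = 0 := by omega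
    simp
  | succ n ih =>
    cases k with
    | zero =>
      obtain rfl : r = n + 1 := by omega
      simp
    | succ k =>
      rw [qbinom_succ_succ, qfact_succ, qfact_succ]
      have h1 := ih k r (by omega)
      cases r with
      | zero =>
        obtain rfl : k = n := by omega
        rw [qbinom_eq_zero y (Nat.lt_succ_self k)]
        simp only [qfact_zero] at h1 ⊢
        linear_combination (1 - y ^ (k + 1)) * h1
      | succ r =>
        have h2 := ih (k + 1) r (by omega)
        rw [qfact_succ] at h1 h2 ⊢
        obtain rfl : n = k + r + 1 := by omega
        linear_combination (1 - y ^ (k + 1)) * h1 + y ^ (k + 1) * (1 - y ^ (r + 1)) * h2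

/-- The finite `q`-binomial theorem. -/
lemma prod_add_mul_pow (a b : R) (n : ℕ) :
    ∏ i ∈ range n, (a + b * y ^ i) =
      ∑ k ∈ range (n + 1), y ^ (k.choose 2) * qbinom y n k * b ^ k * a ^ (n - k) := by
  induction n generalizing b with
  | zero => simp
  | succ n ih =>
    -- Peeling off the factor `i = 0` leaves the same product with `b` replaced by `b * y`.
    rw [prod_range_succ', sum_range_succ']
    have h : ∀ i ∈ range n, a + b * y ^ (i + 1) = a + (b * y) * y ^ i := fun i _ ↦ by ring
    rw [prod_congr rfl h, ih]
    have h2 : ∀ k ∈ range (n + 1),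
        y ^ ((k + 1).choose 2) * qbinom y (n + 1) (k + 1) * b ^ (k + 1) * a ^ (n + 1 - (k + 1)) =
        b * (y ^ (k.choose 2) * qbinom y n k * (b * y) ^ k * a ^ (n - k)) +
        y ^ ((k + 1).choose 2) * qbinom y n (k + 1) * (b * y) ^ (k + 1) * a ^ (n - k) := by
      intro k _
      rw [qbinom_succ_succ, Nat.choose_succ_succ' k 1, Nat.choose_one_right,
        Nat.add_sub_add_right]
      ring
    rw [sum_congr rfl h2, sum_add_distrib, ← mul_sum]
    have h3 : ∑ k ∈ range (n + 1),
        y ^ ((k + 1).choose 2) * qbinom y n (k + 1) * (b * y) ^ (k + 1) * a ^ (n - k) +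
        a ^ (n + 1) =
        a * ∑ k ∈ range (n + 1), y ^ (k.choose 2) * qbinom y n k * (b * y) ^ k * a ^ (n - k) := by
      rw [sum_range_succ, qbinom_eq_zero y (Nat.lt_succ_self n), sum_range_succ' _ n, mul_add,
        mul_sum]
      have : ∀ k ∈ range n,
          y ^ ((k + 1).choose 2) * qbinom y n (k + 1) * (b * y) ^ (k + 1) * a ^ (n - k) =
          a * (y ^ ((k + 1).choose 2) * qbinom y n (k + 1) * (b * y) ^ (k + 1) *
            a ^ (n - (k + 1))) := by
        intro k hk
        obtain ⟨r, rfl⟩ : ∃ r, n = k + 1 + r := ⟨n - (k + 1), by have := mem_range.1 hk; omega⟩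
        rw [show k + 1 + r - k = r + 1 by omega, show k + 1 + r - (k + 1) = r by omega]
        ring
      rw [sum_congr rfl this]
      simp
      ring
    simp only [qbinom_zero_right, Nat.choose_zero_succ, pow_zero, Nat.sub_zero, mul_one, one_mul]
    rw [add_assoc, h3]
    ring

end Ring

/-! ### Reciprocal Pochhammer symbols and Durfee rectangles. -/

/-- The inverse of `(X^d; X^d)_n` in `ℤ⟦X⟧`. -/
noncomputable def eulerInv (d n : ℕ) : ℤ⟦X⟧ := invOfUnit (qfact (X ^ d) n) 1

lemma qfact_mul_eulerInv {d : ℕ} (hd : d ≠ 0) (n : ℕ) :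
    qfact (X ^ d) n * eulerInv d n = 1 :=
  mul_invOfUnit _ _ (by simp [qfact, map_prod, hd])

lemma eulerInv_zero {d : ℕ} (hd : d ≠ 0) : eulerInv d 0 = 1 := by
  simpa using qfact_mul_eulerInv hd 0

lemma eulerInv_succ {d : ℕ} (hd : d ≠ 0) (n : ℕ) :
    (1 - (X ^ d) ^ (n + 1)) * eulerInv d (n + 1) = eulerInv d n := by
  have h1 := qfact_mul_eulerInv hd n
  have h2 := qfact_mul_eulerInv hd (n + 1)
  rw [qfact_succ] at h2
  linear_combination eulerInv d n * h2 - (1 - (X ^ d) ^ (n + 1)) * eulerInv d (n + 1) * h1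

lemma qbinom_eq_eulerInv {d : ℕ} (hd : d ≠ 0) (k r : ℕ) :
    qbinom (X ^ d : ℤ⟦X⟧) (k + r) k = qfact (X ^ d) (k + r) * (eulerInv d k * eulerInv d r) := by
  rw [← qbinom_mul_qfact]
  linear_combination -qbinom (X ^ d : ℤ⟦X⟧) (k + r) k * (qfact_mul_eulerInv hd k +
    qfact (X ^ d) k * eulerInv d k * (qfact_mul_eulerInv hd r))

/-- Durfee rectangle identity. -/
lemma sum_qbinom_mul_eulerInv (k M : ℕ) :
    ∑ r ∈ range (k + 1), X ^ (r * (r + M)) * qbinom (X ^ 1 : ℤ⟦X⟧) k r * eulerInv 1 (r + M) =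
      eulerInv 1 (k + M) := by
  induction k generalizing M with
  | zero => simp
  | succ k ih =>
    rw [sum_range_succ', show k + 1 + M = k + (M + 1) by ring, ← ih (M + 1)]
    -- Pascal's rule splits each term; the two halves recombine through `eulerInv_succ` into the sum
    -- for `M + 1`.
    have h : ∀ r ∈ range (k + 1), X ^ ((r + 1) * (r + 1 + M)) *
        qbinom (X ^ 1 : ℤ⟦X⟧) (k + 1) (r + 1) * eulerInv 1 (r + 1 + M) =
        X ^ (r * (r + (M + 1))) * qbinom (X ^ 1 : ℤ⟦X⟧) k r *
          (X ^ (r + M + 1) * eulerInv 1 (r + M + 1)) +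
        X ^ ((r + 1) * (r + 1 + (M + 1))) * qbinom (X ^ 1 : ℤ⟦X⟧) k (r + 1) *
          eulerInv 1 (r + 1 + M) := by
      intro r _
      rw [qbinom_succ_succ, show r + 1 + M = r + M + 1 by ring]
      ring
    rw [sum_congr rfl h, sum_add_distrib, add_assoc]
    have h2 : ∑ r ∈ range (k + 1), X ^ ((r + 1) * (r + 1 + (M + 1))) *
          qbinom (X ^ 1 : ℤ⟦X⟧) k (r + 1) * eulerInv 1 (r + 1 + M) +
        X ^ (0 * (0 + M)) * qbinom (X ^ 1 : ℤ⟦X⟧) (k + 1) 0 * eulerInv 1 (0 + M) =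
        ∑ r ∈ range (k + 1), X ^ (r * (r + (M + 1))) * qbinom (X ^ 1 : ℤ⟦X⟧) k r *
          eulerInv 1 (r + M) := by
      rw [sum_range_succ, qbinom_eq_zero _ (Nat.lt_succ_self k), sum_range_succ' _ k]
      simp
    rw [h2, ← sum_add_distrib]
    refine sum_congr rfl fun r _ ↦ ?_
    have := eulerInv_succ one_ne_zero (r + M)
    rw [← add_assoc r M 1, ← this]
    ring

/-! ### Finite theta sums and the Bailey chain. -/

lemma two_mul_choose_two (n : ℕ) : (2 : ℤ) * (n.choose 2 : ℕ) = n * (n - 1) := by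
  induction n with
  | zero => simp
  | succ n ih =>
    rw [Nat.choose_succ_succ' n 1, Nat.choose_one_right]
    push_cast
    linear_combination ih

lemma sum_range_two_mul_add_one {M : Type*} [AddCommMonoid M] (f : ℕ → M) (n : ℕ) :
    ∑ k ∈ range (2 * n + 1), f k =
      f n + ∑ m ∈ range n, (f (n + (m + 1)) + f (n - (m + 1))) := by
  rw [show 2 * n + 1 = n + (n + 1) by ring, sum_range_add, sum_range_succ' _ n,
    ← sum_range_reflect f n, sum_add_distrib]
  have : ∀ m ∈ range n, f (n - 1 - m) = f (n - (m + 1)) := fun m _ ↦ by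
    rw [Nat.sub_sub, add_comm 1 m]
  rw [sum_congr rfl this]
  simp only [add_zero]
  abel

/-- The coefficient `(-1)^m (X^{m(m+1)/2} + X^{m(m-1)/2})`, collecting the terms `±m` of a
symmetric bilateral sum. -/
noncomputable def thetaCoeff (m : ℕ) : ℤ⟦X⟧ :=
  if m = 0 then 1 else (-1) ^ m * (X ^ ((m + 1).choose 2) + X ^ (m.choose 2))

/-- The finite theta sum `∑_m (-1)^m X^{m(m+1)/2 + a m²} / ((X^d)_{n-m} (X^d)_{n+m})`. -/
noncomputable def thetaSum (d a n : ℕ) : ℤ⟦X⟧ :=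
  ∑ m ∈ range (n + 1),
    thetaCoeff m * X ^ (a * m ^ 2) * (eulerInv d (n - m) * eulerInv d (n + m))

/-- The `q`-binomial expansion is centred at `k = n`, and the terms `k = n ± m` are paired. The
hypotheses `hu` and `hv` match their exponents with the two monomials of `thetaCoeff m`, up to the
common shift `C`, which is the exponent at `m = 0`. -/
lemma prod_sub_eq_thetaSum {d : ℕ} (hd : d ≠ 0) (a n t C : ℕ)
    (hu : ∀ m ≤ n, d * (n + m).choose 2 + t * (n - m) = C + ((m + 1).choose 2 + a * m ^ 2))
    (hv : ∀ m ≤ n, d * (n - m).choose 2 + t * (n + m) = C + (m.choose 2 + a * m ^ 2)) :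
    ∏ i ∈ range (2 * n), (X ^ t - (X ^ d) ^ i) =
      (-1) ^ n * X ^ C * (qfact (X ^ d) (2 * n) * thetaSum d a n) := by
  have h0 := prod_add_mul_pow (X ^ d : ℤ⟦X⟧) (X ^ t) (-1) (2 * n)
  simp only [neg_mul, one_mul, ← sub_eq_add_neg] at h0
  rw [h0, sum_range_two_mul_add_one, thetaSum, sum_range_succ', add_comm, mul_add, mul_add,
    mul_sum, mul_sum]
  congr 1
  · refine sum_congr rfl fun i hi ↦ ?_
    have hi : i + 1 ≤ n := mem_range.1 hi
    obtain ⟨r, rfl⟩ := Nat.exists_eq_add_of_le hi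
    have e1 := hu (i + 1) hi
    have e2 := hv (i + 1) hi
    have q1 := qbinom_eq_eulerInv hd (i + 1 + r + (i + 1)) r
    have q2 := qbinom_eq_eulerInv hd r (i + 1 + r + (i + 1))
    rw [show i + 1 + r + (i + 1) + r = 2 * (i + 1 + r) by ring] at q1
    rw [show r + (i + 1 + r + (i + 1)) = 2 * (i + 1 + r) by ring] at q2
    have s0 : i + 1 + r - (i + 1) = r := by omega
    have s1 : 2 * (i + 1 + r) - (i + 1 + r + (i + 1)) = r := by omega
    have s2 : 2 * (i + 1 + r) - r = i + 1 + r + (i + 1) := by omega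
    rw [s0] at e1 e2
    rw [s0, s1, s2, q1, q2, thetaCoeff, if_neg (Nat.succ_ne_zero i)]
    have p1 := congrArg (fun e ↦ (X : ℤ⟦X⟧) ^ e) e1
    have p2 := congrArg (fun e ↦ (X : ℤ⟦X⟧) ^ e) e2
    simp only [pow_add _ (d * _), pow_add _ C, pow_mul] at p1 p2
    have sg : ((-1) ^ (i + 1 + r + (i + 1)) : ℤ⟦X⟧) = (-1) ^ r := by
      rw [show i + 1 + r + (i + 1) = r + 2 * (i + 1) by ring, pow_add, pow_mul]; simp
    have sg2 : ((-1) ^ (i + 1 + r) * (-1) ^ (i + 1) : ℤ⟦X⟧) = (-1) ^ r := by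
      rw [← pow_add, sg]
    rw [sg]
    simp only [pow_add _ ((i + 1 + 1).choose 2), pow_add _ ((i + 1).choose 2), pow_mul] at p1 p2 ⊢
    linear_combination
      (-1) ^ r * qfact (X ^ d) (2 * (i + 1 + r)) *
        (eulerInv d r * eulerInv d (i + 1 + r + (i + 1))) * (p1 + p2) -
      X ^ C * qfact (X ^ d) (2 * (i + 1 + r)) * (X ^ a) ^ ((i + 1) ^ 2) *
        (X ^ ((i + 1 + 1).choose 2) + X ^ ((i + 1).choose 2)) *
        (eulerInv d r * eulerInv d (i + 1 + r + (i + 1))) * sg2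
  · have e1 := hu 0 (Nat.zero_le n)
    have q1 := qbinom_eq_eulerInv hd n n
    rw [← two_mul] at q1
    have p1 := congrArg (fun e ↦ (X : ℤ⟦X⟧) ^ e) e1
    simp only [pow_add, pow_mul] at p1
    simp [thetaCoeff, two_mul n] at p1 q1 ⊢
    rw [q1]
    linear_combination (-1) ^ n * qfact (X ^ d) (n + n) * (eulerInv d n * eulerInv d n) * p1

lemma thetaSum_zero_right (n : ℕ) : thetaSum 1 0 n = if n = 0 then 1 else 0 := by
  split_ifs with h
  · subst h
    simp [thetaSum, thetaCoeff, eulerInv_zero]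
  -- With `t = n - 1` the factor `i = n - 1` of the product vanishes.
  · have key := prod_sub_eq_thetaSum one_ne_zero 0 n (n - 1) (3 * n.choose 2) ?_ ?_
    · have h1 : ∏ i ∈ range (2 * n), ((X : ℤ⟦X⟧) ^ (n - 1) - (X ^ 1) ^ i) = 0 :=
        prod_eq_zero (i := n - 1) (by simp; omega) (by simp)
      rw [h1] at key
      have h2 : (-1) ^ n * X ^ (3 * n.choose 2) * qfact (X ^ 1 : ℤ⟦X⟧) (2 * n) ≠ 0 := by
        refine mul_ne_zero (mul_ne_zero (by simp) (pow_ne_zero _ X_ne_zero)) ?_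
        exact left_ne_zero_of_mul_eq_one (qfact_mul_eulerInv one_ne_zero (2 * n))
      rw [← mul_assoc] at key
      exact (mul_eq_zero.1 key.symm).resolve_left h2
    all_goals
      intro m hm
      obtain ⟨r, rfl⟩ := Nat.exists_eq_add_of_le hm
      rw [Nat.add_sub_cancel_left]
      have c1 := two_mul_choose_two (m + r + m)
      have c2 := two_mul_choose_two (m + r)
      have c3 := two_mul_choose_two (m + 1)
      have c4 := two_mul_choose_two m
      have c5 := two_mul_choose_two r
      have : 1 ≤ m + r := by omega
      zify [this]
      push_cast at c1 c2 c3 c4 c5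
      refine mul_left_cancel₀ (two_ne_zero' ℤ) ?_
    · linear_combination c1 - 3 * c2 - c3
    · linear_combination c5 - 3 * c2 - c4

/-- A special case of Bailey's lemma. -/
lemma thetaSum_succ (a n : ℕ) :
    thetaSum 1 (a + 1) n =
      ∑ s ∈ range (n + 1), X ^ (s ^ 2) * eulerInv 1 (n - s) * thetaSum 1 a s := by
  simp only [thetaSum, mul_sum]
  rw [sum_comm' (t' := range (n + 1)) (s' := fun m ↦ Ico m (n + 1))
    (by intro x y; simp only [mem_range, mem_Ico]; omega)]
  refine sum_congr rfl fun m hm ↦ ?_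
  rw [sum_Ico_eq_sum_range]
  obtain ⟨k, rfl⟩ := Nat.exists_eq_add_of_le (Nat.lt_succ_iff.1 (mem_range.1 hm))
  -- After exchanging the sums and putting `s = m + r`, the inner sum is a Durfee rectangle sum with
  -- `M = 2m`.
  have h := congrArg (fun f ↦ eulerInv 1 k * f) (sum_qbinom_mul_eulerInv k (2 * m))
  rw [Nat.add_sub_cancel_left, show m + k + m = k + 2 * m by ring, ← h,
    show m + k + 1 - m = k + 1 by omega, mul_sum, mul_sum]
  refine sum_congr rfl fun r hr ↦ ?_
  obtain ⟨q, rfl⟩ := Nat.exists_eq_add_of_le (Nat.lt_succ_iff.1 (mem_range.1 hr))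
  rw [qbinom_eq_eulerInv one_ne_zero, Nat.add_sub_cancel_left,
    show m + (r + q) - (m + r) = q by omega, show m + r + m = r + 2 * m by ring]
  linear_combination thetaCoeff m * X ^ ((a + 1) * m ^ 2) * X ^ (r * (r + 2 * m)) *
    eulerInv 1 r * eulerInv 1 q * eulerInv 1 (r + 2 * m) *
    qfact_mul_eulerInv one_ne_zero (r + q)

lemma thetaSum_one_right (n : ℕ) : thetaSum 1 1 n = eulerInv 1 n := by
  rw [thetaSum_succ, sum_range_succ']
  simp [thetaSum_zero_right]

lemma thetaSum_two_right (n : ℕ) :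
    thetaSum 1 2 n = ∑ s ∈ range (n + 1), X ^ (s ^ 2) * eulerInv 1 (n - s) * eulerInv 1 s :=
  (thetaSum_succ 1 n).trans (by simp only [thetaSum_one_right])

/-- The factors `i < n`, read backwards, give the exponents `2` mod `5`; the others give `3` mod
`5`. The power of `X` pulled out is the shift `C` of `prod_sub_eq_thetaSum`. -/
lemma prod_sub_pow_five (n : ℕ) (hn : n ≠ 0) :
    ∏ i ∈ range (2 * n), ((X : ℤ⟦X⟧) ^ (5 * n - 3) - (X ^ 5) ^ i) =
      (-1) ^ n * X ^ (5 * n.choose 2 + n * (5 * n - 3)) *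
        ∏ r ∈ range n, ((1 - X ^ (5 * r + 2)) * (1 - X ^ (5 * r + 3))) := by
  rw [two_mul, prod_range_add, prod_mul_distrib, ← prod_range_reflect (fun r ↦ 1 - X ^ (5 * r + 2))]
  have h1 : ∀ i ∈ range n, (X : ℤ⟦X⟧) ^ (5 * n - 3) - (X ^ 5) ^ i =
      (-1) * (X ^ 5) ^ i * (1 - X ^ (5 * (n - 1 - i) + 2)) := by
    intro i hi
    have := mem_range.1 hi
    rw [show 5 * n - 3 = 5 * i + (5 * (n - 1 - i) + 2) by omega, pow_add, pow_mul]
    ring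
  have h2 : ∀ i ∈ range n, (X : ℤ⟦X⟧) ^ (5 * n - 3) - (X ^ 5) ^ (n + i) =
      X ^ (5 * n - 3) * (1 - X ^ (5 * i + 3)) := by
    intro i _
    rw [mul_sub, ← pow_add, ← pow_mul, show 5 * n - 3 + (5 * i + 3) = 5 * (n + i) by omega]
    ring
  rw [prod_congr rfl h1, prod_congr rfl h2]
  simp only [prod_mul_distrib, prod_const, card_range]
  rw [prod_pow_eq_pow_sum, sum_range_id, ← Nat.choose_two_right]
  ring

/-- A finite form of the Jacobi triple product, with theta exponents `m(5m ± 1)/2`. -/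
lemma qfact_mul_thetaSum_five (n : ℕ) :
    qfact (X ^ 5) (2 * n) * thetaSum 5 2 n =
      ∏ r ∈ range n, ((1 - X ^ (5 * r + 2)) * (1 - X ^ (5 * r + 3))) := by
  rcases eq_or_ne n 0 with rfl | hn
  · simp [thetaSum, thetaCoeff, eulerInv_zero]
  have key := prod_sub_eq_thetaSum (d := 5) (by norm_num) 2 n (5 * n - 3)
    (5 * n.choose 2 + n * (5 * n - 3)) ?_ ?_
  · rw [prod_sub_pow_five n hn] at key
    exact (mul_left_cancel₀ (mul_ne_zero (by simp) (pow_ne_zero _ X_ne_zero)) key).symm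
  all_goals
    intro m hm
    obtain ⟨r, rfl⟩ := Nat.exists_eq_add_of_le hm
    rw [Nat.add_sub_cancel_left]
    have c1 := two_mul_choose_two (m + r + m)
    have c2 := two_mul_choose_two (m + r)
    have c3 := two_mul_choose_two (m + 1)
    have c4 := two_mul_choose_two m
    have c5 := two_mul_choose_two r
    have : 3 ≤ 5 * (m + r) := by omega
    zify [this]
    push_cast at c1 c2 c3 c4 c5
    refine mul_left_cancel₀ (two_ne_zero' ℤ) ?_
  · linear_combination 5 * c1 - 5 * c2 - c3
  · linear_combination 5 * c5 - 5 * c2 - c4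

/-! ### The Rogers–Ramanujan identity modulo `X^(n+1)`. -/

lemma X_pow_dvd_eulerInv_sub {d : ℕ} (hd : d ≠ 0) {a n : ℕ} (h : a ≤ n) :
    X ^ (a + 1) ∣ eulerInv d n - eulerInv d a := by
  induction n, h using Nat.le_induction with
  | base => simp
  | succ n hn ih =>
    have h1 : eulerInv d (n + 1) - eulerInv d a =
        (eulerInv d n - eulerInv d a) + (X ^ d) ^ (n + 1) * eulerInv d (n + 1) := by
      linear_combination eulerInv_succ hd n
    rw [h1, ← pow_mul]
    refine dvd_add ih ((pow_dvd_pow X ?_).mul_right _)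
    calc a + 1 ≤ 1 * (n + 1) := by omega
      _ ≤ d * (n + 1) := Nat.mul_le_mul_right _ (Nat.pos_of_ne_zero hd)

section Truncation

variable {d n : ℕ}

lemma mk_X_pow_mul_eulerInv (hd : d ≠ 0) {e a b : ℕ} (ha : n ≤ e + a) (hb : n ≤ e + b) :
    Ideal.Quotient.mk (Ideal.span {(X : ℤ⟦X⟧) ^ (n + 1)}) (X ^ e * eulerInv d a) =
      Ideal.Quotient.mk (Ideal.span {(X : ℤ⟦X⟧) ^ (n + 1)}) (X ^ e * eulerInv d b) := by
  wlog hab : b ≤ a generalizing a b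
  · exact (this hb ha (by omega)).symm
  rw [Ideal.Quotient.mk_eq_mk_iff_sub_mem, Ideal.mem_span_singleton, ← mul_sub]
  exact (pow_dvd_pow X (by omega : n + 1 ≤ e + (b + 1))).trans
    (pow_add (X : ℤ⟦X⟧) e (b + 1) ▸ mul_dvd_mul_left _ (X_pow_dvd_eulerInv_sub hd hab))

lemma mk_thetaSum_two (hd : d ≠ 0) :
    Ideal.Quotient.mk (Ideal.span {(X : ℤ⟦X⟧) ^ (n + 1)}) (thetaSum d 2 n) =
      Ideal.Quotient.mk (Ideal.span {(X : ℤ⟦X⟧) ^ (n + 1)})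
        ((∑ m ∈ range (n + 1), thetaCoeff m * X ^ (2 * m ^ 2)) * eulerInv d n ^ 2) := by
  rw [thetaSum, sum_mul, map_sum, map_sum]
  refine sum_congr rfl fun m hm ↦ ?_
  have hm' : m ≤ m ^ 2 := Nat.le_self_pow two_ne_zero m
  have h1 := mk_X_pow_mul_eulerInv (n := n) hd (e := m ^ 2) (a := n - m) (b := n)
    (by omega) (by omega)
  have h2 := mk_X_pow_mul_eulerInv (n := n) hd (e := m ^ 2) (a := n + m) (b := n)
    (by omega) (by omega)
  -- Each reciprocal takes one factor `X^(m²)`; since `m ≤ m²`, this pushes the error of replacing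
  -- `n ± m` by `n` beyond degree `n`.
  rw [show thetaCoeff m * X ^ (2 * m ^ 2) * (eulerInv d (n - m) * eulerInv d (n + m)) =
    thetaCoeff m * ((X ^ m ^ 2 * eulerInv d (n - m)) * (X ^ m ^ 2 * eulerInv d (n + m))) by ring,
    show thetaCoeff m * X ^ (2 * m ^ 2) * eulerInv d n ^ 2 =
    thetaCoeff m * ((X ^ m ^ 2 * eulerInv d n) * (X ^ m ^ 2 * eulerInv d n)) by ring,
    map_mul, map_mul _ (X ^ m ^ 2 * eulerInv d (n - m)), h1, h2, ← map_mul, ← map_mul]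

end Truncation

lemma qfact_five_mul (n : ℕ) :
    qfact (X ^ 1 : ℤ⟦X⟧) (5 * n) = qfact (X ^ 5) n *
      (∏ r ∈ range n, ((1 - X ^ (5 * r + 2)) * (1 - X ^ (5 * r + 3)))) *
      ∏ r ∈ range n, ((1 - X ^ (5 * r + 1)) * (1 - X ^ (5 * r + 4))) := by
  induction n with
  | zero => simp
  | succ n ih =>
    rw [show 5 * (n + 1) = 5 * n + 1 + 1 + 1 + 1 + 1 by ring]
    simp only [qfact_succ, prod_range_succ, ih]
    ring

/-- The first Rogers–Ramanujan identity, truncated modulo `X^(n+1)`. -/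
theorem X_pow_dvd_rogersRamanujan (n : ℕ) :
    X ^ (n + 1) ∣ (∑ s ∈ range (n + 1), X ^ (s ^ 2) * eulerInv 1 s) *
      (∏ r ∈ range n, ((1 - X ^ (5 * r + 1)) * (1 - X ^ (5 * r + 4)))) - 1 := by
  set F : ℤ⟦X⟧ := ∑ s ∈ range (n + 1), X ^ (s ^ 2) * eulerInv 1 s
  rw [← Ideal.mem_span_singleton, ← Ideal.Quotient.mk_eq_mk_iff_sub_mem]
  set π := Ideal.Quotient.mk (Ideal.span {(X : ℤ⟦X⟧) ^ (n + 1)})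
  set Θ : ℤ⟦X⟧ := ∑ m ∈ range (n + 1), thetaCoeff m * X ^ (2 * m ^ 2)
  have hF : π (thetaSum 1 2 n) = π (eulerInv 1 n * F) := by
    rw [thetaSum_two_right, mul_sum, map_sum, map_sum]
    refine sum_congr rfl fun s hs ↦ ?_
    have hs' : s ≤ s ^ 2 := Nat.le_self_pow two_ne_zero s
    have h1 := mk_X_pow_mul_eulerInv (n := n) one_ne_zero (e := s ^ 2) (a := n - s) (b := n)
      (by omega) (by omega)
    rw [map_mul, h1, ← map_mul]
    congr 1
    ring
  have hA : π (thetaSum 1 2 n) = π (Θ * eulerInv 1 n ^ 2) := mk_thetaSum_two one_ne_zero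
  have hC : π (thetaSum 5 2 n) = π (Θ * eulerInv 5 n ^ 2) := mk_thetaSum_two (by norm_num)
  have hT := congrArg π (qfact_mul_thetaSum_five n)
  have hD := congrArg π (qfact_five_mul n)
  have i1 := congrArg π (qfact_mul_eulerInv one_ne_zero n)
  have i5 := congrArg π (qfact_mul_eulerInv (d := 5) (by norm_num) n)
  have j1 := congrArg π (qfact_mul_eulerInv one_ne_zero (5 * n))
  have j5 := congrArg π (qfact_mul_eulerInv (d := 5) (by norm_num) (2 * n))
  have t1 : π (eulerInv 1 (5 * n)) = π (eulerInv 1 n) := by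
    simpa using mk_X_pow_mul_eulerInv (n := n) one_ne_zero (e := 0) (a := 5 * n) (b := n)
      (by omega) (by omega)
  have t5 : π (eulerInv 5 (2 * n)) = π (eulerInv 5 n) := by
    simpa using mk_X_pow_mul_eulerInv (n := n) (d := 5) (by norm_num) (e := 0) (a := 2 * n)
      (b := n) (by omega) (by omega)
  rw [hF] at hA
  simp only [map_mul π, map_pow π, map_one π, t1, t5] at *
  -- Both evaluations of `thetaSum 1 2 n` contain a factor `eulerInv 1 n`, which is cancelled.
  have hF' : π F = π Θ * π (eulerInv 1 n) := by
    linear_combination π (qfact (X ^ 1) n) * hA - (π F - π Θ * π (eulerInv 1 n)) * i1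
  rw [hC] at hT
  rw [← hT, show π (qfact (X ^ 5) (2 * n)) * (π Θ * π (eulerInv 5 n) ^ 2) =
    π Θ * π (eulerInv 5 n) by linear_combination π Θ * π (eulerInv 5 n) * j5] at hD
  linear_combination π (∏ r ∈ range n, ((1 - X ^ (5 * r + 1)) * (1 - X ^ (5 * r + 4)))) *
    (hF' - π Θ * π (eulerInv 1 n) * i5) + j1 - π (eulerInv 1 n) * hD

/-! ### Generating functions of partitions with prescribed multiplicities. -/

open Classical in
/-- The generating function of the partitions whose multiset of parts satisfies `Φ`. -/
noncomputable def partGF (Φ : Multiset ℕ → Prop) : ℤ⟦X⟧ :=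
  PowerSeries.mk fun d ↦ ((univ.filter fun μ : d.Partition ↦ Φ μ.parts).card : ℤ)

lemma coeff_partGF (Φ : Multiset ℕ → Prop) (d : ℕ) [DecidablePred fun μ : d.Partition ↦ Φ μ.parts] :
    coeff d (partGF Φ) = ((univ.filter fun μ : d.Partition ↦ Φ μ.parts).card : ℤ) := by
  rw [partGF, coeff_mk]
  congr!

lemma partGF_congr {Φ Ψ : Multiset ℕ → Prop} (h : ∀ s, (∀ i ∈ s, 0 < i) → (Φ s ↔ Ψ s)) :
    partGF Φ = partGF Ψ := by
  classical
  ext d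
  rw [coeff_partGF, coeff_partGF]
  congr 2
  exact filter_congr fun μ _ ↦ h _ fun i hi ↦ μ.parts_pos hi

lemma partGF_or {Φ Ψ : Multiset ℕ → Prop} (h : ∀ s, Φ s → ¬ Ψ s) :
    partGF (fun s ↦ Φ s ∨ Ψ s) = partGF Φ + partGF Ψ := by
  classical
  ext d
  rw [map_add, coeff_partGF, coeff_partGF, coeff_partGF, filter_or, card_union_of_disjoint]
  · push_cast; rfl
  · exact disjoint_filter.2 fun μ _ ↦ h _

lemma partGF_false {Φ : Multiset ℕ → Prop} (h : ∀ s, ¬ Φ s) : partGF Φ = 0 := by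
  classical
  ext d
  rw [coeff_partGF, filter_false_of_mem fun μ _ ↦ h _]
  simp

lemma partGF_cons {Φ : Multiset ℕ → Prop} {a : ℕ} (ha : 0 < a) (h : ∀ s, Φ s → a ∈ s) :
    partGF Φ = X ^ a * partGF fun s ↦ Φ (a ::ₘ s) := by
  classical
  ext d
  rw [coeff_X_pow_mul', coeff_partGF]
  split_ifs with had
  · rw [coeff_partGF]
    congr 1
    symm
    refine card_bij (fun μ _ ↦ ⟨a ::ₘ μ.parts, ?_, ?_⟩) ?_ ?_ ?_
    · intro i hi
      rcases Multiset.mem_cons.1 hi with rfl | hi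
      · exact ha
      · exact μ.parts_pos hi
    · rw [Multiset.sum_cons, μ.parts_sum]; omega
    · intro μ hμ
      simpa using hμ
    · intro μ _ ν _ he
      rw [Nat.Partition.mk.injEq, Multiset.cons_inj_right] at he
      exact Nat.Partition.ext he
    · intro ν hν
      have hν : Φ ν.parts := by simpa using hν
      have hc := Multiset.cons_erase (h _ hν)
      refine ⟨⟨ν.parts.erase a, fun hi ↦ ν.parts_pos (Multiset.mem_of_mem_erase hi), ?_⟩, ?_, ?_⟩
      · have := congrArg Multiset.sum hc
        rw [Multiset.sum_cons, ν.parts_sum] at this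
        omega
      · simpa [hc] using hν
      · exact Nat.Partition.ext hc
  · rw [filter_false_of_mem]
    · simp
    · intro μ _ hμ
      have := Multiset.le_sum_of_mem (h _ hμ)
      rw [μ.parts_sum] at this
      exact had this

lemma X_pow_dvd_partGF_sub_one {Φ : Multiset ℕ → Prop} {n : ℕ} (h0 : Φ 0)
    (h : ∀ s, Φ s → ∀ i ∈ s, 0 < i → n < i) : X ^ (n + 1) ∣ partGF Φ - 1 := by
  classical
  rw [X_pow_dvd_iff]
  intro d hd
  rw [map_sub, coeff_partGF, coeff_one]
  split_ifs with hd0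
  · subst hd0
    rw [filter_true_of_mem]
    · simp
    · intro μ _
      rwa [Nat.Partition.partition_zero_parts]
  · rw [filter_false_of_mem]
    · simp
    · intro μ _ hμ
      rcases Multiset.empty_or_exists_mem μ.parts with he | ⟨i, hi⟩
      · have := μ.parts_sum
        rw [he] at this
        exact hd0 this.symm
      · have h1 := h _ hμ i hi (μ.parts_pos hi)
        have h2 := μ.le_of_mem_parts hi
        omega

lemma partGF_eq_one {Φ : Multiset ℕ → Prop} (h : ∀ s, (∀ i ∈ s, 0 < i) → (Φ s ↔ s = 0)) :
    partGF Φ = 1 := by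
  rw [partGF_congr h]
  ext d
  have := X_pow_dvd_iff.1 (X_pow_dvd_partGF_sub_one (Φ := fun s ↦ s = 0) (n := d) rfl
    (by rintro s rfl i hi; simp at hi)) d (Nat.lt_succ_self d)
  rwa [map_sub, sub_eq_zero] at this

lemma partGF_eq (c : Multiset ℕ) (hc : ∀ i ∈ c, 0 < i) : partGF (fun s ↦ s = c) = X ^ c.sum := by
  induction c using Multiset.induction with
  | empty => simpa using partGF_eq_one fun s _ ↦ Iff.rfl
  | cons a c ih =>
    rw [partGF_cons (hc a (Multiset.mem_cons_self a c)) (by rintro s rfl; simp),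
      Multiset.sum_cons, pow_add, ← ih fun i hi ↦ hc i (Multiset.mem_cons_of_mem hi)]
    simp

/-- As `Φ` ignores copies of `a`, deleting one copy shows that the members containing `a` contribute
`X^a * partGF Φ`; the complement is the case `k = 0`, and each further copy costs `X^a`. -/
lemma partGF_count_eq {Φ : Multiset ℕ → Prop} {a : ℕ} (ha : 0 < a)
    (h : ∀ s, Φ (a ::ₘ s) ↔ Φ s) (k : ℕ) :
    partGF (fun s ↦ Φ s ∧ s.count a = k) = X ^ (a * k) * ((1 - X ^ a) * partGF Φ) := by
  induction k with
  | zero =>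
    have h1 : partGF Φ = partGF (fun s ↦ (Φ s ∧ s.count a = 0) ∨ (Φ s ∧ a ∈ s)) :=
      partGF_congr fun s _ ↦ by rw [Multiset.count_eq_zero]; tauto
    have h2 : partGF (fun s ↦ Φ s ∧ a ∈ s) = X ^ a * partGF Φ := by
      rw [partGF_cons ha fun s hs ↦ hs.2]
      simp [h]
    rw [partGF_or (by simp +contextual), h2] at h1
    linear_combination -h1
  | succ k ih =>
    rw [partGF_cons ha fun s hs ↦ Multiset.count_pos.1 (by omega)]
    simp only [Multiset.count_cons_self, h, Nat.add_right_cancel_iff]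
    rw [ih]
    ring

lemma partGF_counts {p : ℕ → Prop} {a b c : ℕ} (ha : 0 < a) (hab : a < b) (hbc : b < c)
    (pa : p a) (pb : p b) (pc : p c) (k j l : ℕ) :
    partGF (fun s ↦ (∀ i ∈ s, p i) ∧ s.count a = k ∧ s.count b = j ∧ s.count c = l) =
      X ^ (a * k + b * j + c * l) *
        ((1 - X ^ a) * (1 - X ^ b) * (1 - X ^ c) * partGF fun s ↦ ∀ i ∈ s, p i) := by
  simp only [← and_assoc]
  rw [partGF_count_eq (by omega), partGF_count_eq (by omega), partGF_count_eq ha]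
  · ring
  · intro s; simp [pa]
  · intro s; simp [pb, hab.ne]
  · intro s; simp [pc, hbc.ne, (hab.trans hbc).ne]

lemma partGF_le_eq_eulerInv (m : ℕ) : partGF (fun s ↦ ∀ i ∈ s, i ≤ m) = eulerInv 1 m := by
  have key : qfact (X ^ 1) m * partGF (fun s ↦ ∀ i ∈ s, i ≤ m) = 1 := by
    induction m with
    | zero =>
      rw [qfact_zero, one_mul]
      refine partGF_eq_one fun s hs ↦ ⟨fun h ↦ Multiset.eq_zero_of_forall_notMem fun i hi ↦ ?_, ?_⟩
      · have := h i hi; have := hs i hi; omega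
      · rintro rfl; simp
    | succ m ih =>
      have h := partGF_count_eq (Φ := fun s ↦ ∀ i ∈ s, i ≤ m + 1) (a := m + 1) (by omega)
        (by simp) 0
      rw [mul_zero, pow_zero, one_mul] at h
      rw [qfact_succ, pow_one, mul_assoc, ← h, ← ih, pow_one]
      congr 1
      refine partGF_congr fun s _ ↦ ?_
      rw [Multiset.count_eq_zero]
      refine ⟨fun ⟨h1, h2⟩ i hi ↦ ?_, fun h1 ↦ ⟨fun i hi ↦ (h1 i hi).trans (by omega), fun h2 ↦ ?_⟩⟩
      · have := h1 i hi
        have : i ≠ m + 1 := by rintro rfl; exact h2 hi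
        omega
      · have := h1 _ h2; omega
  linear_combination eulerInv 1 m * key -
    partGF (fun s ↦ ∀ i ∈ s, i ≤ m) * qfact_mul_eulerInv one_ne_zero m

/-- Each factor `1 - X^a` forbids the part `a`. This avoids infinite products: what remains is `1`
up to high order. -/
lemma prod_mul_partGF_mod_five (n : ℕ) :
    (∏ r ∈ range n, ((1 - X ^ (5 * r + 1)) * (1 - X ^ (5 * r + 4)))) *
      partGF (fun s ↦ ∀ i ∈ s, i % 5 = 1 ∨ i % 5 = 4) =
      partGF (fun s ↦ ∀ i ∈ s, (i % 5 = 1 ∨ i % 5 = 4) ∧ 5 * n < i) := by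
  induction n with
  | zero =>
    rw [range_zero, prod_empty, one_mul]
    refine partGF_congr fun s _ ↦ forall₂_congr fun i _ ↦ ?_
    omega
  | succ n ih =>
    have h1 := partGF_count_eq
      (Φ := fun s ↦ ∀ i ∈ s, (i % 5 = 1 ∨ i % 5 = 4) ∧ 5 * n < i) (a := 5 * n + 1) (by omega)
      (by simp) 0
    have h2 := partGF_count_eq
      (Φ := fun s ↦ (∀ i ∈ s, (i % 5 = 1 ∨ i % 5 = 4) ∧ 5 * n < i) ∧ s.count (5 * n + 1) = 0)
      (a := 5 * n + 4) (by omega) (by simp) 0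
    rw [h1] at h2
    rw [prod_range_succ, mul_right_comm, ih]
    have h3 : partGF (fun s ↦ ∀ i ∈ s, (i % 5 = 1 ∨ i % 5 = 4) ∧ 5 * (n + 1) < i) =
        partGF (fun s ↦ ((∀ i ∈ s, (i % 5 = 1 ∨ i % 5 = 4) ∧ 5 * n < i) ∧
          s.count (5 * n + 1) = 0) ∧ s.count (5 * n + 4) = 0) := by
      refine partGF_congr fun s _ ↦ ?_
      rw [Multiset.count_eq_zero, Multiset.count_eq_zero]
      refine ⟨fun h ↦ ⟨⟨fun i hi ↦ ?_, fun hi ↦ ?_⟩, fun hi ↦ ?_⟩, fun ⟨⟨h, ha⟩, hb⟩ i hi ↦ ?_⟩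
      · have := h i hi; omega
      · have := h _ hi; omega
      · have := h _ hi; omega
      · have := h i hi
        have : i ≠ 5 * n + 1 := by rintro rfl; exact ha hi
        have : i ≠ 5 * n + 4 := by rintro rfl; exact hb hi
        omega
    rw [h3, h2]
    ring

lemma X_pow_dvd_partGF_mod_five_sub (n : ℕ) :
    X ^ (n + 1) ∣ partGF (fun s ↦ ∀ i ∈ s, i % 5 = 1 ∨ i % 5 = 4) -
      ∑ s ∈ range (n + 1), X ^ (s ^ 2) * eulerInv 1 s := by
  have h1 : X ^ (n + 1) ∣
      partGF (fun s ↦ ∀ i ∈ s, (i % 5 = 1 ∨ i % 5 = 4) ∧ 5 * n < i) - 1 :=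
    X_pow_dvd_partGF_sub_one (by simp) fun s hs i hi _ ↦ by have := (hs i hi).2; omega
  rw [← prod_mul_partGF_mod_five] at h1
  have h2 := X_pow_dvd_rogersRamanujan n
  -- With `F` the sum, `G` the generating function and `P` the product: `G(FP - 1) - F(PG - 1) = F -
  -- G`.
  have h3 := dvd_sub (h2.mul_left (partGF (fun s ↦ ∀ i ∈ s, i % 5 = 1 ∨ i % 5 = 4)))
    (h1.mul_left (∑ s ∈ range (n + 1), X ^ (s ^ 2) * eulerInv 1 s))
  rw [← dvd_neg]
  convert h3 using 1
  ring

/-! ### Conjugation of Ferrers diagrams. -/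

lemma lt_countP_iff {s : List ℕ} (hs : s.Pairwise (· ≥ ·)) (c i : ℕ) (hi : i < s.length) :
    i < s.countP (c < ·) ↔ c < s[i] := by
  induction s generalizing i with
  | nil => simp at hi
  | cons a t ih =>
    obtain ⟨h1, h2⟩ := List.pairwise_cons.1 hs
    have hz : ¬ c < a → t.countP (c < ·) = 0 := fun h ↦ List.countP_eq_zero.2 fun b hb ↦ by
      have := h1 b hb; simp; omega
    rw [List.countP_cons]
    cases i with
    | zero => by_cases h : c < a <;> simp [h, hz]
    | succ i =>
      have hi : i < t.length := by simpa using hi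
      have := ih h2 i hi
      have hle := h1 t[i] (List.getElem_mem hi)
      rw [List.getElem_cons_succ]
      by_cases h : c < a
      · simpa [h] using this
      · simp [h, hz h]; omega

/-- Conjugation is an involution: column `c` reaches row `i` exactly when `c < s[i]`. Thus the rows
are recovered from the columns. -/
lemma card_filter_columns {s : List ℕ} (hs : s.Pairwise (· ≥ ·)) (i : ℕ) (hi : i < s.length) :
    ((columns s).filter (i < ·)).card = s[i] := by
  have hle : s[i] ≤ (s : Multiset ℕ).sup :=
    Multiset.le_sup (Multiset.mem_coe.2 (List.getElem_mem hi))
  have h : ∀ c, i < ((s : Multiset ℕ).filter (fun a ↦ c < a)).card ↔ c < s[i] := by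
    intro c
    rw [← Multiset.countP_eq_card_filter, Multiset.coe_countP]
    exact lt_countP_iff hs c i hi
  rw [columns, Multiset.filter_map, Multiset.card_map]
  simp only [Function.comp_def, h]
  change (Finset.filter (fun c ↦ c < s[i]) (Finset.range _)).card = _
  conv_rhs => rw [← Finset.card_range s[i]]
  congr 1
  ext c
  rw [Finset.mem_filter, Finset.mem_range, Finset.mem_range]
  omega

lemma mem_columns {s : List ℕ} {x : ℕ} (hx : x ∈ columns s) : 0 < x ∧ x ≤ s.length := by
  obtain ⟨c, hc, rfl⟩ := Multiset.mem_map.1 hx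
  refine ⟨?_, (Multiset.card_le_card (Multiset.filter_le _ _)).trans (by simp)⟩
  rw [Multiset.mem_range] at hc
  by_contra h
  have h0 := Multiset.card_eq_zero.1 (Nat.eq_zero_of_not_pos h)
  rw [Multiset.filter_eq_nil] at h0
  exact absurd (Multiset.sup_le.2 fun b hb ↦ not_lt.1 (h0 b hb)) (not_le.2 hc)

lemma sum_card_filter_lt {c : Multiset ℕ} {m : ℕ} (hc : ∀ x ∈ c, x ≤ m) :
    ∑ i ∈ range m, (c.filter (i < ·)).card = c.sum := by
  induction c using Multiset.induction with
  | empty => simp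
  | cons a c ih =>
    have ha := hc a (Multiset.mem_cons_self a c)
    rw [Multiset.sum_cons, ← ih fun x hx ↦ hc x (Multiset.mem_cons_of_mem hx)]
    have h1 : ∑ i ∈ range m, (if i < a then 1 else 0) = a := by
      rw [← card_filter]
      conv_rhs => rw [← card_range a]
      congr 1
      ext i
      simp
      omega
    conv_rhs => rw [← h1]
    rw [← sum_add_distrib]
    refine sum_congr rfl fun i _ ↦ ?_
    rw [Multiset.filter_cons, Multiset.card_add]
    split_ifs <;> simp

lemma card_filter_lt_eq (c : Multiset ℕ) (v : ℕ) :
    (c.filter (v < ·)).card = (c.filter (v + 1 < ·)).card + c.count (v + 1) := by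
  induction c using Multiset.induction with
  | empty => simp
  | cons a c ih =>
    rw [Multiset.filter_cons, Multiset.filter_cons, Multiset.card_add, Multiset.card_add,
      Multiset.count_cons, ih]
    split_ifs <;> simp <;> omega

lemma eq_of_card_filter_lt {c c' : Multiset ℕ} {m : ℕ} (hc : ∀ x ∈ c, 0 < x ∧ x ≤ m)
    (hc' : ∀ x ∈ c', 0 < x ∧ x ≤ m)
    (h : ∀ i < m, (c.filter (i < ·)).card = (c'.filter (i < ·)).card) : c = c' := by
  have hz : ∀ {d : Multiset ℕ}, (∀ x ∈ d, 0 < x ∧ x ≤ m) → ∀ i, m ≤ i →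
      (d.filter (i < ·)).card = 0 := fun hd i hi ↦ by
    rw [Multiset.card_eq_zero, Multiset.filter_eq_nil]
    intro x hx
    have := hd x hx
    omega
  have h' : ∀ i, (c.filter (i < ·)).card = (c'.filter (i < ·)).card := fun i ↦ by
    rcases lt_or_ge i m with hi | hi
    · exact h i hi
    · rw [hz hc i hi, hz hc' i hi]
  ext v
  cases v with
  | zero =>
    rw [Multiset.count_eq_zero.2 fun h0 ↦ absurd (hc 0 h0).1 (lt_irrefl 0),
      Multiset.count_eq_zero.2 fun h0 ↦ absurd (hc' 0 h0).1 (lt_irrefl 0)]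
  | succ v =>
    have h1 := card_filter_lt_eq c v
    have h2 := card_filter_lt_eq c' v
    have h3 := h' v
    have h4 := h' (v + 1)
    omega

/-! ### The staircase and the bijection `col`. -/

/-- Remove the staircase `(2m-1, 2m-3, …, 1)` from a list of length `m`. -/
def subStaircase (l : List ℕ) : List ℕ :=
  l.mapIdx fun i a ↦ a - (2 * (l.length - i) - 1)

/-- Add the staircase `(2m-1, 2m-3, …, 1)` to a list of length `m`. -/
def addStaircase (l : List ℕ) : List ℕ :=
  l.mapIdx fun i a ↦ a + (2 * (l.length - i) - 1)

lemma subStaircase_cons (a : ℕ) (l : List ℕ) :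
    subStaircase (a :: l) = (a - (2 * l.length + 1)) :: subStaircase l := by
  simp only [subStaircase, List.mapIdx_cons, List.length_cons, Nat.add_sub_add_right]
  rfl

lemma addStaircase_cons (a : ℕ) (l : List ℕ) :
    addStaircase (a :: l) = (a + (2 * l.length + 1)) :: addStaircase l := by
  simp only [addStaircase, List.mapIdx_cons, List.length_cons, Nat.add_sub_add_right]
  rfl

@[simp] lemma length_subStaircase (l : List ℕ) : (subStaircase l).length = l.length := by
  simp [subStaircase]

@[simp] lemma length_addStaircase (l : List ℕ) : (addStaircase l).length = l.length := by
  simp [addStaircase]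

lemma subStaircase_addStaircase (l : List ℕ) : subStaircase (addStaircase l) = l := by
  induction l with
  | nil => rfl
  | cons a l ih => rw [addStaircase_cons, subStaircase_cons, ih]; simp

lemma addStaircase_pos {l : List ℕ} : ∀ x ∈ addStaircase l, 0 < x := by
  induction l with
  | nil => simp [addStaircase]
  | cons a l ih => rw [addStaircase_cons]; simpa using ih

lemma sum_addStaircase (l : List ℕ) : (addStaircase l).sum = l.sum + l.length ^ 2 := by
  induction l with
  | nil => rfl
  | cons a l ih => rw [addStaircase_cons, List.sum_cons, ih, List.sum_cons, List.length_cons]; ring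

lemma isChain_addStaircase {l : List ℕ} (hl : l.IsChain (fun a b ↦ b ≤ a)) :
    (addStaircase l).IsChain (fun a b ↦ b + 2 ≤ a) := by
  induction l with
  | nil => exact List.isChain_nil
  | cons a l ih =>
    cases l with
    | nil => exact List.isChain_singleton _
    | cons b l =>
      rw [List.isChain_cons_cons] at hl
      have := ih hl.2
      rw [addStaircase_cons] at this ⊢
      rw [addStaircase_cons, List.isChain_cons_cons]
      refine ⟨?_, this⟩
      have := hl.1
      simp only [List.length_cons]
      omega

lemma subStaircase_of_isChain {l : List ℕ} (hl : l.IsChain (fun a b ↦ b + 2 ≤ a))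
    (hpos : ∀ x ∈ l, 0 < x) :
    (subStaircase l).IsChain (fun a b ↦ b ≤ a) ∧ addStaircase (subStaircase l) = l := by
  -- The induction also carries the bound `2m - 1 ≤ λ₁`, so that no natural subtraction truncates.
  suffices h : (subStaircase l).IsChain (fun a b ↦ b ≤ a) ∧ addStaircase (subStaircase l) = l ∧
      ∀ a ∈ l.head?, 2 * l.length ≤ a + 1 from ⟨h.1, h.2.1⟩
  induction l with
  | nil => simp [subStaircase, addStaircase]
  | cons a l ih =>
    have hp := fun x hx ↦ hpos x (List.mem_cons_of_mem a hx)
    have ha := hpos a List.mem_cons_self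
    cases l with
    | nil =>
      simp [subStaircase, addStaircase]
      omega
    | cons b l =>
      rw [List.isChain_cons_cons] at hl
      obtain ⟨h1, h2, h3⟩ := ih hl.2 hp
      have h3 := h3 b rfl
      have h4 := hl.1
      simp only [List.length_cons] at h3
      rw [subStaircase_cons, addStaircase_cons, h2]
      refine ⟨?_, ?_, ?_⟩
      · rw [subStaircase_cons] at h1 ⊢
        refine List.isChain_cons_cons.2 ⟨?_, h1⟩
        simp only [List.length_cons]
        omega
      · simp only [length_subStaircase, List.length_cons]
        congr 1
        omega
      · simp
        omega

lemma sortedParts_coe {N : ℕ} (p : N.Partition) : (sortedParts p : Multiset ℕ) = p.parts :=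
  Multiset.sort_eq _ _

lemma length_sortedParts {N : ℕ} (p : N.Partition) : (sortedParts p).length = p.parts.card := by
  rw [← sortedParts_coe, Multiset.coe_card]

lemma removeStaircase_eq {N : ℕ} (p : N.Partition) :
    removeStaircase p = subStaircase (sortedParts p) := by
  rw [removeStaircase, subStaircase, length_sortedParts]

lemma sortedParts_pos {N : ℕ} (p : N.Partition) : ∀ x ∈ sortedParts p, 0 < x := fun x hx ↦
  p.parts_pos (by rwa [← sortedParts_coe, Multiset.mem_coe])

lemma length_removeStaircase {N : ℕ} (p : N.Partition) :
    (removeStaircase p).length = p.parts.card := by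
  rw [removeStaircase_eq, length_subStaircase, length_sortedParts]

lemma pairwise_of_isChain {l : List ℕ} (hl : l.IsChain (fun a b ↦ b ≤ a)) :
    l.Pairwise (· ≥ ·) :=
  List.isChain_iff_pairwise.1 hl

lemma Diff2.isChain_removeStaircase {N : ℕ} {p : N.Partition} (hp : Diff2 p) :
    (removeStaircase p).IsChain (fun a b ↦ b ≤ a) := by
  rw [removeStaircase_eq]
  exact (subStaircase_of_isChain hp (sortedParts_pos p)).1

lemma Diff2.addStaircase_removeStaircase {N : ℕ} {p : N.Partition} (hp : Diff2 p) :
    addStaircase (removeStaircase p) = sortedParts p := by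
  rw [removeStaircase_eq]
  exact (subStaircase_of_isChain hp (sortedParts_pos p)).2

lemma sum_columns {s : List ℕ} (hs : s.Pairwise (· ≥ ·)) : (columns s).sum = s.sum := by
  rw [← sum_card_filter_lt fun x hx ↦ (mem_columns hx).2, sum_range,
    ← Fin.sum_univ_getElem s]
  exact Fintype.sum_congr _ _ fun i ↦ card_filter_columns hs i i.2

lemma Diff2.sum_col {N : ℕ} {p : N.Partition} (hp : Diff2 p) :
    (col p).sum + p.parts.card ^ 2 = N := by
  have h := congrArg List.sum hp.addStaircase_removeStaircase
  rw [sum_addStaircase, length_removeStaircase] at h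
  rw [col, sum_columns (pairwise_of_isChain hp.isChain_removeStaircase), h, ← Multiset.sum_coe,
    sortedParts_coe, p.parts_sum]

lemma mem_col {N : ℕ} {p : N.Partition} {x : ℕ} (hx : x ∈ col p) : 0 < x ∧ x ≤ p.parts.card := by
  rw [← length_removeStaircase]
  exact mem_columns hx

lemma Diff2.eq_of_col_eq {N : ℕ} {p q : N.Partition} (hp : Diff2 p) (hq : Diff2 q)
    (hc : p.parts.card = q.parts.card) (h : col p = col q) : p = q := by
  have hr : removeStaircase p = removeStaircase q := by
    refine List.ext_getElem (by rw [length_removeStaircase, length_removeStaircase, hc]) ?_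
    intro i h1 h2
    rw [← card_filter_columns (pairwise_of_isChain hp.isChain_removeStaircase) i h1,
      ← card_filter_columns (pairwise_of_isChain hq.isChain_removeStaircase) i h2]
    exact congrArg (fun c ↦ (Multiset.filter (i < ·) c).card) h
  refine Nat.Partition.ext ?_
  rw [← sortedParts_coe, ← sortedParts_coe, ← hp.addStaircase_removeStaircase, hr,
    hq.addStaircase_removeStaircase]

lemma exists_diff2_col_eq {N m : ℕ} {c : Multiset ℕ} (hc : ∀ x ∈ c, 0 < x ∧ x ≤ m)
    (hN : c.sum + m ^ 2 = N) : ∃ p : N.Partition, Diff2 p ∧ p.parts.card = m ∧ col p = c := by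
  -- The rows of the diagram whose columns are `c`.
  set s : List ℕ := List.ofFn fun i : Fin m ↦ (c.filter (i.1 < ·)).card with hs
  have hlen : s.length = m := by simp [hs]
  have hget : ∀ i (hi : i < s.length), s[i] = (c.filter (i < ·)).card := by simp [hs]
  have hsort : s.Pairwise (· ≥ ·) := by
    rw [List.pairwise_iff_getElem]
    intro i j hi hj hij
    rw [hget, hget]
    exact Multiset.card_le_card (Multiset.monotone_filter_right _ fun x hx ↦ hij.trans hx)
  have hchain : s.IsChain (fun a b ↦ b ≤ a) := hsort.isChain
  have hsum : s.sum = c.sum := by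
    rw [← sum_card_filter_lt fun x hx ↦ (hc x hx).2, hs, List.sum_ofFn, sum_range]
  let p : N.Partition := ⟨addStaircase s, fun hi ↦ addStaircase_pos _ hi, by
    rw [Multiset.sum_coe, sum_addStaircase, hlen, hsum, hN]⟩
  have hch := isChain_addStaircase hchain
  have hsp : sortedParts p = addStaircase s := by
    have : (addStaircase s).IsChain (fun a b ↦ b ≤ a) :=
      hch.imp fun a b hab ↦ by omega
    refine List.Perm.eq_of_pairwise' ?_ (pairwise_of_isChain this) ?_
    · exact Multiset.pairwise_sort _ _
    · exact Multiset.coe_eq_coe.1 (sortedParts_coe p)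
  have hrm : removeStaircase p = s := by
    rw [removeStaircase_eq, hsp, subStaircase_addStaircase]
  refine ⟨p, by rwa [Diff2, hsp], ?_, ?_⟩
  · rw [← length_removeStaircase, hrm, hlen]
  · refine eq_of_card_filter_lt (m := m) (fun x hx ↦ ?_) hc fun i hi ↦ ?_
    · have := mem_col hx
      rwa [← length_removeStaircase, hrm, hlen] at this
    · rw [col, hrm, card_filter_columns hsort i (by omega), hget]

open Classical in
/-- Partitions in `Diff₂` with `m` parts correspond under `col` to partitions into parts
at most `m`. -/
lemma card_diff2_eq_coeff (N m : ℕ) (Φ : Multiset ℕ → Prop) :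
    ((univ.filter fun p : N.Partition ↦ Diff2 p ∧ p.parts.card = m ∧ Φ (col p)).card : ℤ) =
      coeff N (X ^ (m ^ 2) * partGF fun s ↦ (∀ i ∈ s, i ≤ m) ∧ Φ s) := by
  rw [coeff_X_pow_mul']
  split_ifs with hm
  · rw [coeff_partGF]
    congr 1
    refine card_bij (fun p hp ↦ ⟨col p, fun hi ↦ (mem_col hi).1, ?_⟩) ?_ ?_ ?_
    · have hp := (mem_filter.1 hp).2
      have := hp.1.sum_col
      rw [hp.2.1] at this
      omega
    · intro p hp
      have hp := (mem_filter.1 hp).2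
      rw [mem_filter]
      exact ⟨mem_univ _, fun i hi ↦ hp.2.1 ▸ (mem_col hi).2, hp.2.2⟩
    · intro p hp q hq h
      have hp := (mem_filter.1 hp).2
      have hq := (mem_filter.1 hq).2
      exact hp.1.eq_of_col_eq hq.1 (hp.2.1.trans hq.2.1.symm) (Nat.Partition.mk.inj h)
    · intro μ hμ
      have hμ := (mem_filter.1 hμ).2
      obtain ⟨p, h1, h2, h3⟩ := exists_diff2_col_eq (N := N) (m := m) (c := μ.parts)
        (fun x hx ↦ ⟨μ.parts_pos hx, hμ.1 x hx⟩) (by rw [μ.parts_sum]; omega)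
      refine ⟨p, mem_filter.2 ⟨mem_univ _, h1, h2, ?_⟩, Nat.Partition.ext h3⟩
      rw [h3]
      exact hμ.2
  · rw [filter_false_of_mem]
    · simp
    · rintro p - ⟨h1, h2, -⟩
      have := h1.sum_col
      rw [h2] at this
      omega

/-! ### Generating functions of the column conditions. -/

/-- The condition on `col λ` when `λ` has `m` parts. -/
def ColCondition (k j l m : ℕ) (s : Multiset ℕ) : Prop :=
  (6 ≤ m → s.count 1 = k ∧ s.count 4 = j ∧ s.count 6 = l) ∧
  (m = 4 ∨ m = 5 →
    s.count 1 = k ∧ s.count 4 = j ∧ (s.count 3 = 2 * l ∨ s.count 3 = 2 * l + 1)) ∧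
  (m = 3 →
    s = threesTwosOnes (2 * l) (2 * j) k ∨
    s = threesTwosOnes (2 * l) (2 * j + 1) k ∨
    (s = threesTwosOnes (2 * l - 3) (2 * j) k ∧ 2 ≤ l) ∨
    s = threesTwosOnes (2 * l + 1) (2 * j + 1) k) ∧
  (m = 2 →
    (s = threesTwosOnes 0 (2 * j - 2) k ∧ 1 ≤ j ∧ l = 0) ∨
    (s = threesTwosOnes 0 (2 * j + 1) k ∧ l = 1)) ∧
  (m = 1 → s = threesTwosOnes 0 0 (k - 1) ∧ 1 ≤ k ∧ j = 0 ∧ l = 0)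

/-- The generating function of the multisets `col λ`, for `λ` with `m` parts. -/
noncomputable def colGF (k j l m : ℕ) : ℤ⟦X⟧ :=
  partGF fun s ↦ (∀ i ∈ s, i ≤ m) ∧ ColCondition k j l m s

lemma threesTwosOnes_inj {a b c a' b' c' : ℕ} :
    threesTwosOnes a b c = threesTwosOnes a' b' c' ↔ a = a' ∧ b = b' ∧ c = c' := by
  refine ⟨fun h ↦ ⟨?_, ?_, ?_⟩, by rintro ⟨rfl, rfl, rfl⟩; rfl⟩
  · simpa [threesTwosOnes, Multiset.count_replicate] using congrArg (Multiset.count 3) h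
  · simpa [threesTwosOnes, Multiset.count_replicate] using congrArg (Multiset.count 2) h
  · simpa [threesTwosOnes, Multiset.count_replicate] using congrArg (Multiset.count 1) h

lemma mem_threesTwosOnes {a b c i : ℕ} :
    i ∈ threesTwosOnes a b c ↔ (a ≠ 0 ∧ i = 3) ∨ (b ≠ 0 ∧ i = 2) ∨ (c ≠ 0 ∧ i = 1) := by
  simp [threesTwosOnes, Multiset.mem_replicate, or_assoc]

lemma partGF_threesTwosOnes (a b c : ℕ) :
    partGF (fun s ↦ s = threesTwosOnes a b c) = X ^ (3 * a + 2 * b + c) := by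
  rw [partGF_eq]
  · congr 1
    simp [threesTwosOnes]
    ring
  · intro i hi
    rw [mem_threesTwosOnes] at hi
    omega

/-- For `m = 4, 5` no part `6` is available. Allowing `2l` or `2l + 1` threes gives `X^(6l) (1 +
X^3)(1 - X^3)`, which equals `X^(6l) (1 - X^6)`. -/
lemma colGF_of_four_le (k j l : ℕ) {m : ℕ} (hm : 4 ≤ m) :
    colGF k j l m = X ^ (1 * k + 4 * j + 6 * l) *
      ((1 - X ^ 1) * (1 - X ^ 4) * (1 - X ^ 6) * eulerInv 1 m) := by
  rcases le_or_gt 6 m with h6 | h6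
  · rw [← partGF_le_eq_eulerInv, ← partGF_counts (p := fun i ↦ i ≤ m) (by norm_num) (by norm_num)
      (by norm_num) (by omega) (by omega) h6]
    refine partGF_congr fun s _ ↦ ?_
    have h1 : ¬ (m = 4 ∨ m = 5) := by omega
    have h2 : m ≠ 3 := by omega
    have h3 : m ≠ 2 := by omega
    have h4 : m ≠ 1 := by omega
    simp [ColCondition, h6, h1, h2, h3, h4]
  · have h : colGF k j l m = partGF fun s ↦
        ((∀ i ∈ s, i ≤ m) ∧ s.count 1 = k ∧ s.count 3 = 2 * l ∧ s.count 4 = j) ∨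
        ((∀ i ∈ s, i ≤ m) ∧ s.count 1 = k ∧ s.count 3 = 2 * l + 1 ∧ s.count 4 = j) := by
      refine partGF_congr fun s _ ↦ ?_
      have h1 : m = 4 ∨ m = 5 := by omega
      have h2 : m ≠ 3 := by omega
      have h3 : m ≠ 2 := by omega
      have h4 : m ≠ 1 := by omega
      simp only [ColCondition, h6.not_ge, h1, h2, h3, h4, false_imp_iff, true_and, and_true,
        true_imp_iff]
      tauto
    rw [h, partGF_or (by rintro s ⟨-, -, h1, -⟩ ⟨-, -, h2, -⟩; omega),
      partGF_counts (p := fun i ↦ i ≤ m) (by norm_num) (by norm_num) (by norm_num) (by omega)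
        (by omega) hm,
      partGF_counts (p := fun i ↦ i ≤ m) (by norm_num) (by norm_num) (by norm_num) (by omega)
        (by omega) hm,
      partGF_le_eq_eulerInv]
    ring

lemma partGF_threesTwosOnes_and (a b c : ℕ) (P : Prop) [Decidable P] :
    partGF (fun s ↦ s = threesTwosOnes a b c ∧ P) = if P then X ^ (3 * a + 2 * b + c) else 0 := by
  split_ifs with h
  · simp only [h, and_true, partGF_threesTwosOnes]
  · exact partGF_false fun s hs ↦ h hs.2

/-- Relative to (a), (b) has one more `2` and (d) one more `2` and one more `3`, whence `X^2` and
`X^5`. In (c) the three missing threes cancel the staircase `X^9`; `2 ≤ l` keeps `2 * l - 3` from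
truncating. -/
lemma X_pow_mul_colGF_three (k j l : ℕ) :
    X ^ 9 * colGF k j l 3 = X ^ (1 * k + 4 * j + 6 * l) * (X ^ 9 * (1 + X ^ 2 + X ^ 5)) +
      if 2 ≤ l then X ^ (1 * k + 4 * j + 6 * l) else 0 := by
  have h : colGF k j l 3 = partGF fun s ↦
      s = threesTwosOnes (2 * l) (2 * j) k ∨
      s = threesTwosOnes (2 * l) (2 * j + 1) k ∨
      (s = threesTwosOnes (2 * l - 3) (2 * j) k ∧ 2 ≤ l) ∨
      s = threesTwosOnes (2 * l + 1) (2 * j + 1) k := by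
    refine partGF_congr fun s _ ↦ ?_
    have : ∀ {a b c}, s = threesTwosOnes a b c → ∀ i ∈ s, i ≤ 3 := by
      rintro a b c rfl i hi
      rw [mem_threesTwosOnes] at hi
      omega
    simp only [ColCondition, Nat.reduceLeDiff, Nat.reduceEqDiff, false_imp_iff, true_and, and_true,
      true_imp_iff, or_self]
    refine and_iff_right_of_imp ?_
    rintro (h | h | ⟨h, -⟩ | h) <;> exact this h
  rw [h, partGF_or, partGF_or, partGF_or]
  · simp only [partGF_threesTwosOnes, partGF_threesTwosOnes_and]
    split_ifs with hl
    · have : (X : ℤ⟦X⟧) ^ (1 * k + 4 * j + 6 * l) =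
          X ^ 9 * X ^ (3 * (2 * l - 3) + 2 * (2 * j) + k) := by
        rw [← pow_add]; congr 1; omega
      linear_combination -this
    · ring
  all_goals
    intro s h1
    simp only [h1, threesTwosOnes_inj, not_or, not_and]
    omega

/-- The sizes fit since `4 + 2(2j - 2) = 4j` and `4 + 2(2j + 1) = 4j + 6`. -/
lemma X_pow_mul_colGF_two (k j l : ℕ) :
    X ^ 4 * colGF k j l 2 =
      if (1 ≤ j ∧ l = 0) ∨ l = 1 then X ^ (1 * k + 4 * j + 6 * l) else 0 := by
  have h : colGF k j l 2 = partGF fun s ↦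
      (s = threesTwosOnes 0 (2 * j - 2) k ∧ 1 ≤ j ∧ l = 0) ∨
      (s = threesTwosOnes 0 (2 * j + 1) k ∧ l = 1) := by
    refine partGF_congr fun s _ ↦ ?_
    have : ∀ {b c}, s = threesTwosOnes 0 b c → ∀ i ∈ s, i ≤ 2 := by
      rintro b c rfl i hi
      rw [mem_threesTwosOnes] at hi
      omega
    simp only [ColCondition, Nat.reduceLeDiff, Nat.reduceEqDiff, false_imp_iff, true_and, and_true,
      true_imp_iff, or_self]
    refine and_iff_right_of_imp ?_
    rintro (⟨h, -⟩ | ⟨h, -⟩) <;> exact this h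
  rw [h, partGF_or (by rintro s ⟨-, -, h0⟩ ⟨-, h1⟩; omega), partGF_threesTwosOnes_and,
    partGF_threesTwosOnes_and]
  by_cases h0 : 1 ≤ j ∧ l = 0
  · rw [if_pos h0, if_neg (by omega), if_pos (Or.inl h0), add_zero, ← pow_add]
    congr 1
    omega
  · rw [if_neg h0, zero_add, mul_ite, ← pow_add]
    simp only [h0, false_or]
    split_ifs
    · congr 1
      omega
    · exact mul_zero _

lemma X_mul_colGF_one (k j l : ℕ) :
    X ^ 1 * colGF k j l 1 =
      if 1 ≤ k ∧ j = 0 ∧ l = 0 then X ^ (1 * k + 4 * j + 6 * l) else 0 := by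
  have h : colGF k j l 1 = partGF fun s ↦
      s = threesTwosOnes 0 0 (k - 1) ∧ 1 ≤ k ∧ j = 0 ∧ l = 0 := by
    refine partGF_congr fun s _ ↦ ?_
    have : ∀ {c}, s = threesTwosOnes 0 0 c → ∀ i ∈ s, i ≤ 1 := by
      rintro c rfl i hi
      rw [mem_threesTwosOnes] at hi
      omega
    simp only [ColCondition, Nat.reduceLeDiff, Nat.reduceEqDiff, false_imp_iff, true_and,
      true_imp_iff, or_self]
    exact and_iff_right_of_imp fun h ↦ this h.1
  rw [h, partGF_threesTwosOnes_and, mul_ite, ← pow_add]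
  split_ifs
  · congr 1
    omega
  · exact mul_zero _

lemma colGF_zero (k j l : ℕ) : colGF k j l 0 = 1 := by
  refine partGF_eq_one fun s hs ↦ ?_
  simp only [ColCondition, Nat.reduceLeDiff, Nat.reduceEqDiff, false_imp_iff, and_true,
    or_self]
  refine ⟨fun h ↦ Multiset.eq_zero_of_forall_notMem fun i hi ↦ ?_, ?_⟩
  · have := h i hi; have := hs i hi; omega
  · rintro rfl; simp

lemma sum_eulerInv_lt_four :
    (1 - X ^ 1) * (1 - X ^ 4) * (1 - X ^ 6) * ∑ m ∈ range 4, X ^ (m ^ 2) * eulerInv 1 m =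
      1 + X ^ 9 * (1 + X ^ 2 + X ^ 5) := by
  have h0 := eulerInv_zero one_ne_zero
  have h1 := eulerInv_succ one_ne_zero 0
  have h2 := eulerInv_succ one_ne_zero 1
  have h3 := eulerInv_succ one_ne_zero 2
  norm_num at h1 h2 h3
  simp only [sum_range_succ, range_zero, sum_empty]
  norm_num
  rw [h0] at h1 ⊢
  have e2 : (1 - X) * (1 - X ^ 2) * eulerInv 1 2 = 1 := by linear_combination (1 - X) * h2 + h1
  have e3 : (1 - X) * (1 - X ^ 2) * (1 - X ^ 3) * eulerInv 1 3 = 1 := by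
    linear_combination (1 - X) * (1 - X ^ 2) * h3 + e2
  linear_combination (1 - X ^ 4) * (1 - X ^ 6) * X * h1 + (1 + X ^ 2) * (1 - X ^ 6) * X ^ 4 * e2 +
    (1 + X ^ 2) * (1 + X ^ 3) * X ^ 9 * e3

lemma coeff_sum_colGF (N : ℕ) (hN : 1 ≤ N) (k j l : ℕ) :
    coeff N (∑ m ∈ range (N + 6), X ^ (m ^ 2) * colGF k j l m) =
      coeff N (X ^ (1 * k + 4 * j + 6 * l) * ((1 - X ^ 1) * (1 - X ^ 4) * (1 - X ^ 6) *
        ∑ m ∈ range (N + 6), X ^ (m ^ 2) * eulerInv 1 m)) := by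
  rw [show N + 6 = 4 + (N + 2) by ring, sum_range_add _ 4 (N + 2), sum_range_add _ 4 (N + 2),
    mul_add, sum_eulerInv_lt_four, mul_add, map_add, map_add]
  congr 1
  -- The empty partition always contributes `1`. It is the needed `X^w` when `k = j = l = 0`, and
  -- otherwise a surplus constant, invisible in degree `N ≥ 1`.
  · have h : ∑ m ∈ range 4, X ^ (m ^ 2) * colGF k j l m =
        X ^ (1 * k + 4 * j + 6 * l) * (1 + X ^ 9 * (1 + X ^ 2 + X ^ 5)) +
          if k = 0 ∧ j = 0 ∧ l = 0 then 0 else 1 := by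
      have h1 := X_mul_colGF_one k j l
      have h2 := X_pow_mul_colGF_two k j l
      have h3 := X_pow_mul_colGF_three k j l
      simp only [sum_range_succ, range_zero, sum_empty]
      norm_num only
      rw [h1, h2, h3, colGF_zero]
      by_cases h0 : k = 0 ∧ j = 0 ∧ l = 0
      · obtain ⟨rfl, rfl, rfl⟩ := h0
        simp
      · split_ifs <;> first | omega | ring
    rw [h, map_add]
    have : coeff N (if k = 0 ∧ j = 0 ∧ l = 0 then 0 else 1 : ℤ⟦X⟧) = 0 := by
      split_ifs
      · simp
      · rw [coeff_one, if_neg (by omega)]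
    rw [this, add_zero]
  · congr 1
    rw [mul_sum, mul_sum]
    refine sum_congr rfl fun i _ ↦ ?_
    rw [colGF_of_four_le k j l (by omega)]
    ring

end RRRefinement

/-! ### Comparison of coefficients. -/

open RRRefinement in
theorem mainTheorem11 (N : ℕ) (hN : 1 ≤ N) (k j l : ℕ) :
    ((Nat.Partition.restricted N (fun i => i % 5 = 1 ∨ i % 5 = 4)).filter
        (fun μ => μ.parts.count 1 = k ∧ μ.parts.count 4 = j ∧ μ.parts.count 6 = l)).card =
      (Finset.univ.filter (fun p : N.Partition =>
        Diff2 p ∧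
        (6 ≤ p.parts.card →
          (col p).count 1 = k ∧ (col p).count 4 = j ∧ (col p).count 6 = l) ∧
        (p.parts.card = 4 ∨ p.parts.card = 5 →
          (col p).count 1 = k ∧ (col p).count 4 = j ∧
            ((col p).count 3 = 2 * l ∨ (col p).count 3 = 2 * l + 1)) ∧
        (p.parts.card = 3 →
          col p = threesTwosOnes (2 * l) (2 * j) k ∨
          col p = threesTwosOnes (2 * l) (2 * j + 1) k ∨
          (col p = threesTwosOnes (2 * l - 3) (2 * j) k ∧ 2 ≤ l) ∨
          col p = threesTwosOnes (2 * l + 1) (2 * j + 1) k) ∧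
        (p.parts.card = 2 →
          (col p = threesTwosOnes 0 (2 * j - 2) k ∧ 1 ≤ j ∧ l = 0) ∨
          (col p = threesTwosOnes 0 (2 * j + 1) k ∧ l = 1)) ∧
        (p.parts.card = 1 →
          col p = threesTwosOnes 0 0 (k - 1) ∧ 1 ≤ k ∧ j = 0 ∧ l = 0))).card := by
  classical
  refine Nat.cast_injective (R := ℤ) ?_
  have hL : (((Nat.Partition.restricted N (fun i => i % 5 = 1 ∨ i % 5 = 4)).filter
      (fun μ => μ.parts.count 1 = k ∧ μ.parts.count 4 = j ∧ μ.parts.count 6 = l)).card : ℤ) =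
      PowerSeries.coeff N (partGF fun s ↦ (∀ i ∈ s, i % 5 = 1 ∨ i % 5 = 4) ∧
        s.count 1 = k ∧ s.count 4 = j ∧ s.count 6 = l) := by
    rw [coeff_partGF, Nat.Partition.restricted, Finset.filter_filter]
  -- A partition of `N` has at most `N` parts, so the range `N + 6` omits none; it also has room for
  -- splitting off `m < 4`.
  have hR : ((Finset.univ.filter (fun p : N.Partition =>
      Diff2 p ∧ ColCondition k j l p.parts.card (col p))).card : ℤ) =
      PowerSeries.coeff N (∑ m ∈ Finset.range (N + 6), PowerSeries.X ^ (m ^ 2) * colGF k j l m) := by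
    rw [Finset.card_eq_sum_card_fiberwise (f := fun p ↦ p.parts.card) (t := Finset.range (N + 6)),
      Nat.cast_sum, map_sum]
    · refine Finset.sum_congr rfl fun m _ ↦ ?_
      rw [colGF, ← card_diff2_eq_coeff, Finset.filter_filter]
      congr 2
      refine Finset.filter_congr fun p _ ↦ ⟨?_, ?_⟩
      · rintro ⟨⟨h1, h2⟩, rfl⟩
        exact ⟨h1, rfl, h2⟩
      · rintro ⟨h1, rfl, h2⟩
        exact ⟨⟨h1, h2⟩, rfl⟩
    · intro p _
      have h := Multiset.card_nsmul_le_sum (s := p.parts) (a := 1) fun x hx ↦ p.parts_pos hx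
      rw [p.parts_sum, smul_eq_mul, mul_one] at h
      simp only [Finset.coe_range, Set.mem_Iio]
      omega
  rw [hL]
  refine Eq.trans ?_ ((hR.trans (coeff_sum_colGF N hN k j l)).symm.trans ?_)
  · rw [partGF_counts (by norm_num) (by norm_num) (by norm_num) (by norm_num) (by norm_num)
      (by norm_num), ← sub_eq_zero, ← map_sub, ← mul_sub, ← mul_sub]
    exact PowerSeries.X_pow_dvd_iff.1
      (((X_pow_dvd_partGF_mod_five_sub (N + 5)).mul_left _).mul_left _) N
      (by omega)
  · congr!
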